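/- **Definitions.** An *input/output stochastic automaton with urgency* (IOSA) consists of a countable set $\mathcal S$ of states; a countable set $\mathcal A$ of labels partitioned into inputs $\mathcal A^{\mathsf i}$ and outputs $\mathcal A^{\mathsf o}$, with a subset $\mathcal A^{\mathsf u}\subseteq\mathcal A$ of urgent labels and a silent label $\tau\in\mathcal A^{\mathsf u}\cap\mathcal A^{\mathsf o}$; a finite set $\mathcal C$ of clocks, each $x\in\mathcal C$ with an atomless probability measure $\mu_x$ on $\mathbb R$ such that $\mu_x(\mathbb R_{>0})=1$; a set of transitions $s\xrightarrow{C,a,C'}s'$ with $s,s'\in\mathcal S$, $a\in\mathcal A$, $C,C'\subseteq\mathcal C$; a set $C_0\subseteq\mathcal C$; and an initial state $s_0$. Call $s$ *stable* if no $s\xrightarrow{\emptyset,a,C'}s'$ with $a\in\mathcal A^{\mathsf u}\cap\mathcal A^{\mathsf o}$ exists, and let $\mathrm{enabling}(s)=\{y\mid \exists a,C',s':\ s\xrightarrow{\{y\},a,C'}s'\}$. It is required that - (a) if $s\xrightarrow{C,a,C'}s'$ and $a\in\mathcal A^{\mathsf i}\cup\mathcal A^{\mathsf u}$, then $C=\emptyset$;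 - (b) if $s\xrightarrow{C,a,C'}s'$ and $a\in\mathcal A^{\mathsf o}\setminus\mathcal A^{\mathsf u}$, then $C$ is a singleton; - (c) if $s\xrightarrow{\{x\},a_1,C_1}s_1$ and $s\xrightarrow{\{x\},a_2,C_2}s_2$, then $a_1=a_2$, $C_1=C_2$, $s_1=s_2$; - (d) for all $a\in\mathcal A^{\mathsf i}$ and $s$ there is a transition $s\xrightarrow{\emptyset,a,C'}s'$; - (e) if $a\in\mathcal A^{\mathsf i}$, $s\xrightarrow{\emptyset,a,C_1}s_1$ and $s\xrightarrow{\emptyset,a,C_2}s_2$, then $C_1=C_2$ and $s_1=s_2$; - (f) there is $\mathrm{active}:\mathcal S\to 2^{\mathcal C}$ with $\mathrm{active}(s_0)\subseteq C_0$; $\mathrm{enabling}(s)\subseteq\mathrm{active}(s)$ for all $s$, with equality if $s$ is stable; and $\mathrm{active}(s)\subseteq(\mathrm{active}(t)\setminus C)\cup C'$ whenever $t\xrightarrow{C,a,C'}s$. The IOSA is *closed* if $\mathcal A^{\mathsf i}=\emptyset$. It is *confluent* if for all $a,b\in\mathcal A^{\mathsf u}$ and all transitions $s\xrightarrow{\emptyset,a,C_1}s_1$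 and $s\xrightarrow{\emptyset,b,C_2}s_2$ that are not one and the same transition, there is a state $s_3$ with $s_1\xrightarrow{\emptyset,b,C_2}s_3$ and $s_2\xrightarrow{\emptyset,a,C_1}s_3$. *Semantics.* The state space is $\mathbf S=(\mathcal S\cup\{\mathsf{init}\})\times\mathbb R^{\mathcal C}$ with its Borel $\sigma$-algebra ($\mathcal S\cup\{\mathsf{init}\}$ discrete), and the labels are $\mathcal A\cup\mathbb R_{>0}\cup\{\mathsf{init}\}$. For $v\in\mathbb R^{\mathcal C}$ let $\mu^{v}_{C,s}=\delta_s\times\prod_{x}\overline\mu_x$, with $\overline\mu_x=\mu_x$ for $x\in C$ and $\overline\mu_x=\delta_{v(x)}$ otherwise. Put $\mathcal T_{\mathsf{init}}(\mathsf{init},v)=\{\delta_{s_0}\times\prod_x\mu_x\}$. For $a\in\mathcal A$ and $s\in\mathcal S$ put $\mathcal T_a(s,v)=\{\mu^v_{C',s'}\mid s\xrightarrow{C,a,C'}s',\ v(x)\le 0\text{ for all }x\in C\}$. For $d>0$ and $s\in\mathcal S\cup\{\mathsf{init}\}$ put $\mathcal T_d(s,v)=\{\delta_s\times\prod_x\delta_{v(x)-d}\}$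 if no transition with a label in $\mathcal A^{\mathsf o}\cap\mathcal A^{\mathsf u}$ leaves $s$ and $d\le v(x)$ for every clock $x$ such that $s\xrightarrow{\{x\},a,C'}s'$ for some $a\in\mathcal A^{\mathsf o}$, $C'$, $s'$ (no transition leaves $\mathsf{init}$, which counts as stable). All other sets $\mathcal T_\ell(s,v)$ are empty. *Weak transitions.* Write $s\xrightarrow{C}_{\mathsf u}s'$ if $s\xrightarrow{\emptyset,a,C}s'$ for some $a\in\mathcal A^{\mathsf u}$. The relations $(s,v)\Rightarrow^{C}_n\mu$ ($n\ge1$) are given inductively by two rules. (T1) If $s\xrightarrow{C}_{\mathsf u}s'$ and $s'$ is stable, then $(s,v)\Rightarrow^C_1\mu^v_{C,s'}$. (T2) If $s\xrightarrow{C'}_{\mathsf u}s'$ and $C''$ is such that for every $v'\in\mathbb R^{\mathcal C}$ there is $\mu'$ with $(s',v')\Rightarrow^{C''}_n\mu'$, then $(s,v)\Rightarrow^{C'\cup C''}_{n+1}\int f^{C''}_n\,d\mu^v_{C',s'}$. Here $f^{C}_n(p)=\nu$ if $p\Rightarrow^{C}_n\nu$, and $f^{C}_n(p)$ is the zero measure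 if there is no such $\nu$. They are *well defined* if each $f^{C}_n$ is single-valued and measurable. Write $p\Rightarrow\mu$ if $p\Rightarrow^C_n\mu$ for some $n\ge1$ and $C$. *Almost never.* A scheduler assigns, measurably, to each finite path (alternating states and labels) a probability distribution over the pairs $(\ell,\mu)$, concentrated on those with $\mu\in\mathcal T_\ell(p)$, where $p$ is the last state of the path. With a starting state it induces a probability measure on infinite paths. A measurable $B\subseteq\mathbf S$ is *almost never reached* from $p_0$ if, under every scheduler, the set of paths from $p_0$ that visit $B$ has measure $0$. A closed IOSA is *weakly deterministic* if its weak transitions are well defined and every measurable $B\subseteq\mathbf S$, each of whose elements $(s,v)$ satisfies one of (i)–(iii) below, is almost never reached from any $(\mathsf{init},v_0)$: - (i) $s$ is stable and $\bigcup_{a\in\mathcal A\cup\{\mathsf{init}\}}\mathcal T_a(s,v)$ contains at least two different measures; - (ii) $s$ is not stable, and $(s,v)\Rightarrow\mu$ and $(s,v)\Rightarrow\mu'$ for some $\mu\ne\mu'$; - (iii) $s$ is not stable and $\mathcal T_a(s,v)\neq\emptyset$ for some $a\in\mathcal A^{\mathsf o}\setminus\mathcal A^{\mathsf u}$. **Theorem.**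 Every closed, confluent IOSA is weakly deterministic. -/

import Mathlib

open MeasureTheory ProbabilityTheory

noncomputable section

/-! ### Paths and schedulers of nondeterministic labelled Markov processes

A process with labels `L` and state space `X` is given by its transition function
`T : L → X → Set (ProbabilityMeasure X)`. -/

section Paths

variable {L X : Type*} [MeasurableSpace L] [MeasurableSpace X]

/-- One entry of a path `x₀ ℓ₁ x₁ ℓ₂ x₂ …`: the starting state `x₀`, or a pair `(ℓₙ, xₙ)`. -/
abbrev PathEntry (L X : Type*) := X ⊕ (L × X)

/-- The state in an entry of a path. -/
def PathEntry.state : PathEntry L X → X := Sum.elim id Prod.snd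

/-- Finite paths with `n` transitions. -/
abbrev History (L X : Type*) (n : ℕ) := (_ : Finset.Iic n) → PathEntry L X

/-- The last state of a finite path. -/
def History.last {n : ℕ} (h : History L X n) : X :=
  PathEntry.state (h ⟨n, Finset.mem_Iic.2 le_rfl⟩)

/-- A (randomized, history-dependent, measurable) scheduler: after each finite path it selects a
probability distribution over the labelled transitions that leave the last state of the path. -/
structure Scheduler (T : L → X → Set (ProbabilityMeasure X)) where
  choice : (n : ℕ) → Kernel (History L X n) (L × ProbabilityMeasure X)
  markov : ∀ n, IsMarkovKernel (choice n)
  admissible : ∀ n (h : History L X n), ∀ᵐ p ∂(choice n h), p.2 ∈ T p.1 h.last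

/-- Sampling a state from a given probability measure. -/
def sampleKernel (X : Type*) [MeasurableSpace X] : Kernel (ProbabilityMeasure X) X where
  toFun μ := (μ : Measure X)
  measurable' := measurable_subtype_coe

instance : IsMarkovKernel (sampleKernel X) := ⟨fun μ => μ.2⟩

/-- Executing a selected transition `(ℓ, μ)`: the label `ℓ` is kept, and the next state is
sampled from `μ`. -/
def execKernel (L X : Type*) [MeasurableSpace L] [MeasurableSpace X] :
    Kernel (L × ProbabilityMeasure X) (L × X) :=
  Kernel.deterministic Prod.fst measurable_fst ×ₖ (sampleKernel X).comap Prod.snd measurable_snd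

instance : IsMarkovKernel (execKernel L X) := by
  unfold execKernel; infer_instance

namespace Scheduler

variable {T : L → X → Set (ProbabilityMeasure X)}

/-- The distribution of the next entry of the path, given the path so far. -/
def step (η : Scheduler T) (n : ℕ) : Kernel (History L X n) (PathEntry L X) :=
  (execKernel L X ∘ₖ η.choice n).map Sum.inr

instance (η : Scheduler T) (n : ℕ) : IsMarkovKernel (η.step n) := by
  have := η.markov n
  exact Kernel.IsMarkovKernel.map _ measurable_inr

/-- The probability measure on infinite paths starting in `x₀` under the scheduler `η`. -/
def pathMeasure (η : Scheduler T) (x₀ : X) : Measure (ℕ → PathEntry L X) :=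
  Kernel.traj (X := fun _ => PathEntry L X) η.step 0 (fun _ => Sum.inl x₀)

end Scheduler

/-- The set `B` is almost never reached from `x₀`: under every scheduler, the set of the paths
from `x₀` that visit `B` has measure zero. -/
def AlmostNeverReached (T : L → X → Set (ProbabilityMeasure X)) (x₀ : X) (B : Set X) : Prop :=
  ∀ η : Scheduler T, η.pathMeasure x₀ {ω | ∃ n, PathEntry.state (ω n) ∈ B} = 0

end Paths

/-! ### Input/output stochastic automata with urgency -/

/-- The clocks that enable some transition in state `s`. -/
def enablingClocks {S A C : Type*} (trans : S → Set C → A → Set C → S → Prop) (s : S) : Set C :=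
  {y | ∃ a K' s', trans s {y} a K' s'}

/-- A state is stable if no transition labelled in `UO` (the urgent outputs) leaves it. -/
def IsStableState {S A C : Type*} (trans : S → Set C → A → Set C → S → Prop) (UO : Set A)
    (s : S) : Prop :=
  ¬ ∃ a ∈ UO, ∃ K' s', trans s ∅ a K' s'

/-- Input/output stochastic automata with urgency, with states `S`, labels `A` and clocks `C`.
`trans s K a K' s'` is the transition from `s` to `s'` with label `a` that is controlled by the
clocks in `K` and resets the clocks in `K'`. The output labels are the labels that are not
inputs. -/
structure IOSA (S A C : Type*) where
  input : Set A
  urgent : Set A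
  /-- the silent action -/
  tau : A
  tau_mem : tau ∈ urgent ∩ inputᶜ
  /-- the distribution of each clock -/
  clock : C → ProbabilityMeasure ℝ
  clock_continuous : ∀ x (r : ℝ), (clock x : Measure ℝ) {r} = 0
  clock_pos : ∀ x, (clock x : Measure ℝ) (Set.Ioi 0) = 1
  trans : S → Set C → A → Set C → S → Prop
  initClocks : Set C
  s₀ : S
  reactive : ∀ s K a K' s', trans s K a K' s' → a ∈ input ∪ urgent → K = ∅
  generative : ∀ s K a K' s', trans s K a K' s' → a ∈ inputᶜ \ urgent → ∃ x, K = {x}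
  clock_controls_one : ∀ s x a₁ K₁ s₁ a₂ K₂ s₂,
    trans s {x} a₁ K₁ s₁ → trans s {x} a₂ K₂ s₂ → a₁ = a₂ ∧ K₁ = K₂ ∧ s₁ = s₂
  input_enabled : ∀ a ∈ input, ∀ s, ∃ K' s', trans s ∅ a K' s'
  input_deterministic : ∀ a ∈ input, ∀ s K₁ s₁ K₂ s₂,
    trans s ∅ a K₁ s₁ → trans s ∅ a K₂ s₂ → K₁ = K₂ ∧ s₁ = s₂
  exists_active : ∃ active : S → Set C,
    active s₀ ⊆ initClocks ∧
    (∀ s, enablingClocks trans s ⊆ active s) ∧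
    (∀ s, IsStableState trans (urgent ∩ inputᶜ) s → active s = enablingClocks trans s) ∧
    (∀ t K a K' s, trans t K a K' s → active s ⊆ (active t \ K) ∪ K')

/-- The states of an automaton together with the additional location `init`. -/
inductive Loc (S : Type*)
  | init : Loc S
  | at (s : S) : Loc S

/-- The discrete labels: the labels of the automaton and the additional label `init`. -/
inductive DiscreteLabel (A : Type*)
  | init : DiscreteLabel A
  | act (a : A) : DiscreteLabel A

instance {S : Type*} : MeasurableSpace (Loc S) := ⊤
instance {S : Type*} : DiscreteMeasurableSpace (Loc S) := ⟨fun _ => trivial⟩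
instance {A : Type*} : MeasurableSpace (DiscreteLabel A) := ⊤
instance {A : Type*} : DiscreteMeasurableSpace (DiscreteLabel A) := ⟨fun _ => trivial⟩

/-- The labels of the semantics: discrete labels and delays `d > 0`. -/
abbrev SemLabel (A : Type*) := DiscreteLabel A ⊕ Set.Ioi (0 : ℝ)

/-- The states of the semantics: locations with clock valuations. For countable `S`, the product
σ-algebra is the Borel σ-algebra. -/
abbrev SemState (S C : Type*) := Loc S × (C → ℝ)

/-- The product measure of the point mass at `q` and the measures `m x` of the clock values. -/
def locProd {S C : Type*} [Fintype C] (q : Loc S) (m : C → ProbabilityMeasure ℝ) :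
    ProbabilityMeasure (SemState S C) :=
  ⟨(Measure.dirac q).prod (Measure.pi fun x => (m x : Measure ℝ)), inferInstance⟩

namespace IOSA

variable {S A C : Type*} (I : IOSA S A C)

/-- The output labels. -/
def output : Set A := I.inputᶜ

/-- There are no input labels. -/
def Closed : Prop := I.input = ∅

/-- No urgent output leaves the state `s`. -/
def Stable (s : S) : Prop := IsStableState I.trans (I.urgent ∩ I.output) s

/-- Stability of locations; no transition of the automaton leaves `init`. -/
def StableLoc : Loc S → Prop
  | .init => True
  | .at s => I.Stable s

/-- Confluence with respect to two labels: two transitions from a common state with these labels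
are the same transition, or they can be completed to a diamond. -/
def ConfluentWrt (a b : A) : Prop :=
  ∀ s K₁ s₁ K₂ s₂, I.trans s ∅ a K₁ s₁ → I.trans s ∅ b K₂ s₂ →
    (a = b ∧ K₁ = K₂ ∧ s₁ = s₂) ∨ ∃ s₃, I.trans s₁ ∅ b K₂ s₃ ∧ I.trans s₂ ∅ a K₁ s₃

/-- Confluence with respect to every pair of urgent labels. -/
def Confluent : Prop := ∀ a ∈ I.urgent, ∀ b ∈ I.urgent, I.ConfluentWrt a b

section Semantics

variable [Fintype C]

open Classical in
/-- The measure `μ^v_{K,s}`: the location is `s`, the clocks in `K` are sampled from their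
distributions and the others keep their values in `v`. -/
def resample (v : C → ℝ) (K : Set C) (s : S) : ProbabilityMeasure (SemState S C) :=
  locProd (.at s) fun x => if x ∈ K then I.clock x else diracProba (v x)

/-- The discrete transitions of the semantics. -/
def discreteT : DiscreteLabel A → SemState S C → Set (ProbabilityMeasure (SemState S C))
  | .init, (.init, _) => {locProd (.at I.s₀) I.clock}
  | .act a, (.at s, v) =>
      {μ | ∃ K K' s', I.trans s K a K' s' ∧ (∀ x ∈ K, v x ≤ 0) ∧ μ = I.resample v K' s'}
  | _, _ => ∅

/-- `d` time units may pass in a location with clock values `v`: no urgent output is possible,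
and `d` is at most the value of each clock that controls an output. -/
def CanDelay (d : ℝ) : SemState S C → Prop
  | (.init, _) => True
  | (.at s, v) =>
      (¬ ∃ b ∈ I.output ∩ I.urgent, ∃ K K' s', I.trans s K b K' s') ∧
      ∀ x, (∃ a ∈ I.output, ∃ K' s', I.trans s {x} a K' s') → d ≤ v x

/-- The time transitions of the semantics. -/
def delayT (d : Set.Ioi (0 : ℝ)) (p : SemState S C) : Set (ProbabilityMeasure (SemState S C)) :=
  {μ | I.CanDelay d p ∧ μ = locProd p.1 fun x => diracProba (p.2 x - d)}

/-- The transition function of the semantics of the automaton. -/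
def semT : SemLabel A → SemState S C → Set (ProbabilityMeasure (SemState S C)) :=
  Sum.elim I.discreteT I.delayT

/-! ### Weak transitions -/

/-- A transition with an urgent label, that is, a transition with label `τ` once all the urgent
labels are renamed to `τ`. -/
def UrgentTrans (s : S) (K : Set C) (s' : S) : Prop := ∃ a ∈ I.urgent, I.trans s ∅ a K s'

open Classical in
/-- The function that sends a state to the measure that `R` relates to it, and to the zero
measure if there is none. -/
def measureOf (R : SemState S C → Measure (SemState S C) → Prop) (p : SemState S C) :
    Measure (SemState S C) :=
  if h : ∃ ν, R p ν then h.choose else 0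

/-- `WeakStep n K p μ`: from `p`, the measure `μ` on stable states is reached by `n` urgent
transitions that together reset the clocks in `K`. The last step is a single urgent transition to
a stable state. If an urgent transition leads to a state `s'` from which, for all clock values,
there is a weak transition with `n` steps that resets `K''`, then the measures reached by the
latter are averaged; `Measure.bind m f` is the measure `B ↦ ∫ f(q)(B) dm(q)`. -/
def WeakStep : ℕ → Set C → SemState S C → Measure (SemState S C) → Prop
  | 0, _, _, _ => False
  | n + 1, K, p, μ =>
      (n = 0 ∧ ∃ s s', p.1 = .at s ∧ I.UrgentTrans s K s' ∧ I.Stable s' ∧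
        μ = I.resample p.2 K s') ∨
      (∃ s K' s' K'', p.1 = .at s ∧ I.UrgentTrans s K' s' ∧
        (∀ v', ∃ μ', WeakStep n K'' (.at s', v') μ') ∧ K = K' ∪ K'' ∧
        μ = (I.resample p.2 K' s' : Measure (SemState S C)).bind (measureOf (WeakStep n K'')))

/-- The weak transition relation. -/
def WeakTrans (p : SemState S C) (μ : Measure (SemState S C)) : Prop :=
  ∃ n ≥ 1, ∃ K, I.WeakStep n K p μ

/-- The weak transitions are well defined: the functions that are integrated in their definition
are single-valued and measurable. -/
def WeakTransWellDefined : Prop :=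
  ∀ n ≥ 1, ∀ K : Set C,
    (∀ p μ μ', I.WeakStep n K p μ → I.WeakStep n K p μ' → μ = μ') ∧
    Measurable (measureOf (I.WeakStep n K))

/-! ### Weak determinism -/

/-- Two different discrete transitions are enabled in a stable state. -/
def TwoDiscrete (p : SemState S C) : Prop :=
  I.StableLoc p.1 ∧ ∃ a b, ∃ μ ∈ I.discreteT a p, ∃ μ' ∈ I.discreteT b p, μ ≠ μ'

/-- Weak transitions from an unstable state lead to different measures. -/
def TwoWeak (p : SemState S C) : Prop :=
  ¬ I.StableLoc p.1 ∧ ∃ μ μ', I.WeakTrans p μ ∧ I.WeakTrans p μ' ∧ μ ≠ μ'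

/-- A non-urgent output is enabled in an unstable state. -/
def NonUrgentUnstable (p : SemState S C) : Prop :=
  ¬ I.StableLoc p.1 ∧ ∃ a ∈ I.output \ I.urgent, ∃ μ, μ ∈ I.discreteT (.act a) p

/-- Weak determinism (of a closed automaton). -/
structure WeaklyDeterministic : Prop where
  wellDefined : I.WeakTransWellDefined
  almostNever : ∀ (v₀ : C → ℝ) (B : Set (SemState S C)), MeasurableSet B →
    (∀ p ∈ B, I.TwoDiscrete p ∨ I.TwoWeak p ∨ I.NonUrgentUnstable p) →
    AlmostNeverReached I.semT (.init, v₀) B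

end Semantics

end IOSA

end

/-!
Confluence lets two different urgent transitions from a common state be completed to a diamond.
Completing diamonds one after the other permutes the transitions of a run, so all maximal sequences
of urgent transitions from a state collect the same multiset of reset sets and end in the same
state. Resampling the clocks in `K` and then those in `K'` has the same law as resampling the clocks
in `K ∪ K'` once, so the iterated integral that defines a weak transition collapses to a single
resampling of the clocks reset along such a run. Hence weak transitions are unique and measurable.

The other two sources of nondeterminism require that a clock has expired in an unstable state, or
that two of them have expired in a stable one. Both are impossible if the active clocks have
different, nonnegative values that are positive in unstable states. Such states are left with
probability zero only: new samples are positive and avoid each other and the values of the other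
clocks because clock laws are atomless, and a delay happens only in a stable state, where it cannot
exceed the value of any active clock.
-/

/-! ### Almost surely invariant sets of states -/

section Invariants

variable {L X : Type*} [MeasurableSpace L] [MeasurableSpace X]

theorem PathEntry.measurable_state : Measurable (PathEntry.state : PathEntry L X → X) :=
  measurable_fun_sum measurable_id measurable_snd

theorem History.measurable_last (n : ℕ) : Measurable (History.last : History L X n → X) :=
  PathEntry.measurable_state.comp (measurable_pi_apply _)

theorem execKernel_apply (p : L × ProbabilityMeasure X) :
    execKernel L X p = (Measure.dirac p.1).prod (p.2 : Measure X) := by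
  rw [execKernel, Kernel.prod_apply, Kernel.deterministic_apply, Kernel.comap_apply]
  rfl

/-- A set of states is almost surely invariant if every transition from one of its elements leads
to it with probability one. -/
def AlmostSurelyInvariant (T : L → X → Set (ProbabilityMeasure X)) (G : Set X) : Prop :=
  ∀ p ∈ G, ∀ ℓ, ∀ μ ∈ T ℓ p, ∀ᵐ q ∂(μ : Measure X), q ∈ G

namespace AlmostSurelyInvariant

variable {T : L → X → Set (ProbabilityMeasure X)} {G : Set X} {x₀ : X}

theorem ae_step (hT : AlmostSurelyInvariant T G) (hG : MeasurableSet G) (η : Scheduler T) {n : ℕ}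
    {h : History L X n} (hh : h.last ∈ G) : ∀ᵐ e ∂η.step n h, PathEntry.state e ∈ G := by
  rw [Scheduler.step, Kernel.map_apply _ measurable_inr,
    ae_map_iff measurable_inr.aemeasurable (PathEntry.measurable_state hG)]
  refine Kernel.ae_comp_of_ae_ae (measurable_snd hG) ?_
  filter_upwards [η.admissible n h] with p hp
  rw [execKernel_apply, Measure.dirac_prod]
  exact (ae_map_iff measurable_prodMk_left.aemeasurable (measurable_snd hG)).2 (hT _ hh _ _ hp)

theorem ae_partialTraj_last (hT : AlmostSurelyInvariant T G) (hG : MeasurableSet G)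
    (η : Scheduler T) (hx₀ : x₀ ∈ G) (n : ℕ) :
    ∀ᵐ h ∂Kernel.partialTraj (X := fun _ => PathEntry L X) η.step 0 n (fun _ => Sum.inl x₀),
      History.last h ∈ G := by
  induction n with
  | zero =>
    rw [Kernel.partialTraj_self, Kernel.id_apply, ae_dirac_iff (History.measurable_last 0 hG)]
    exact hx₀
  | succ n ih =>
    rw [Kernel.partialTraj_succ_eq_comp (Nat.zero_le n)]
    refine Kernel.ae_comp_of_ae_ae (History.measurable_last (n + 1) hG) ?_
    filter_upwards [ih] with h hh
    have hstep := hT.ae_step hG η hh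
    rw [← Kernel.map_partialTraj_succ_self (X := fun _ => PathEntry L X) (κ := η.step) n,
      Kernel.map_apply _ (measurable_pi_apply _)] at hstep
    exact ae_of_ae_map (measurable_pi_apply _).aemeasurable hstep

theorem ae_pathMeasure (hT : AlmostSurelyInvariant T G) (hG : MeasurableSet G) (η : Scheduler T)
    (hx₀ : x₀ ∈ G) : ∀ᵐ ω ∂η.pathMeasure x₀, ∀ n, PathEntry.state (ω n) ∈ G := by
  refine ae_all_iff.2 fun n => ?_
  have hn := hT.ae_partialTraj_last hG η hx₀ n
  rw [← Kernel.traj_map_frestrictLe_apply] at hn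
  exact ae_of_ae_map (Preorder.measurable_frestrictLe n).aemeasurable hn

theorem almostNeverReached (hT : AlmostSurelyInvariant T G) (hG : MeasurableSet G) (hx₀ : x₀ ∈ G)
    {B : Set X} (hB : Disjoint B G) : AlmostNeverReached T x₀ B := by
  intro η
  refine measure_mono_null ?_ (ae_iff.1 (hT.ae_pathMeasure hG η hx₀))
  rintro ω ⟨n, hn⟩ hω
  exact Set.disjoint_left.1 hB hn (hω n)

end AlmostSurelyInvariant

end Invariants

/-! ### Product measures -/

section Product

theorem bind_map_prodMk {X Y Z : Type*} [MeasurableSpace X] [MeasurableSpace Y]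
    [MeasurableSpace Z] (μ : Measure X) (ν : Measure Y) [SFinite ν] {f : X × Y → Z}
    (hf : Measurable f) :
    μ.bind (fun x => ν.map fun y => f (x, y)) = (μ.prod ν).map f := by
  have hmap : ∀ x, (ν.map fun y => f (x, y)) = (ν.map (Prod.mk x)).map f := fun x =>
    (Measure.map_map hf measurable_prodMk_left).symm
  have hmeas : Measurable fun x => ν.map fun y => f (x, y) := by
    simp only [hmap]
    exact (Measure.measurable_map f hf).comp Measurable.map_prodMk_left
  ext s hs
  rw [Measure.bind_apply hs hmeas.aemeasurable, Measure.map_apply hf hs,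
    Measure.prod_apply (hf hs)]
  exact lintegral_congr fun x => Measure.map_apply (hf.comp measurable_prodMk_left) hs

variable {ι : Type*} {X : ι → Type*}

theorem piecewise_piecewise_eq_union_piecewise (K K' : Set ι) [∀ i, Decidable (i ∈ K)]
    [∀ i, Decidable (i ∈ K')] {_ : ∀ i, Decidable (i ∈ K ∪ K')} (x y z : ∀ i, X i) :
    K'.piecewise z (K.piecewise y x) = (K ∪ K').piecewise (K'.piecewise z y) x := by
  ext i
  by_cases hi : i ∈ K <;> by_cases hi' : i ∈ K' <;> simp [hi, hi']

theorem injOn_union_piecewise {Y : Type*} {D K : Set ι} [∀ i, Decidable (i ∈ K)] {v w : ι → Y}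
    (hv : D.InjOn v) (hw : K.InjOn w) (hne : ∀ i j, w i ≠ v j) :
    (D ∪ K).InjOn (K.piecewise w v) := by
  intro i hi j hj hij
  by_cases hiK : i ∈ K <;> by_cases hjK : j ∈ K <;>
    simp only [Set.piecewise, hiK, hjK, if_true, if_false] at hij
  · exact hw hiK hjK hij
  · exact absurd hij (hne i j)
  · exact absurd hij.symm (hne j i)
  · exact hv (hi.resolve_right hiK) (hj.resolve_right hjK) hij

variable [∀ i, MeasurableSpace (X i)]

open Classical in
theorem measurable_overwrite (K : Set ι) :
    Measurable fun p : (∀ i, X i) × (∀ i, X i) => K.piecewise p.2 p.1 := by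
  refine measurable_pi_lambda _ fun i => ?_
  by_cases hi : i ∈ K
  · simp only [Set.piecewise_eq_of_mem _ _ _ hi]
    fun_prop
  · simp only [Set.piecewise_eq_of_notMem _ _ _ hi]
    fun_prop

variable [Fintype ι]

open Classical in
theorem measurePreserving_overwrite (μ ν : ∀ i, Measure (X i)) [∀ i, IsProbabilityMeasure (μ i)]
    [∀ i, IsProbabilityMeasure (ν i)] (K : Set ι) :
    MeasurePreserving (fun p : (∀ i, X i) × (∀ i, X i) => K.piecewise p.2 p.1)
      ((Measure.pi μ).prod (Measure.pi ν)) (Measure.pi (K.piecewise ν μ)) := by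
  have hprob : ∀ i, IsProbabilityMeasure (K.piecewise ν μ i) := fun i => by
    rw [Set.piecewise]
    split_ifs <;> infer_instance
  refine ⟨measurable_overwrite K, (Measure.pi_eq fun t ht => ?_).symm⟩
  have hpreimage : (fun p : (∀ i, X i) × (∀ i, X i) => K.piecewise p.2 p.1) ⁻¹' Set.univ.pi t =
      Set.univ.pi (K.piecewise (fun _ => Set.univ) t) ×ˢ
        Set.univ.pi (K.piecewise t fun _ => Set.univ) := by
    ext p
    simp only [Set.mem_preimage, Set.mem_univ_pi, Set.mem_prod, ← forall_and]
    refine forall_congr' fun i => ?_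
    by_cases hi : i ∈ K <;> simp [hi]
  rw [Measure.map_apply (measurable_overwrite K) (.univ_pi ht), hpreimage, Measure.prod_prod,
    Measure.pi_pi, Measure.pi_pi, ← Finset.prod_mul_distrib]
  refine Finset.prod_congr rfl fun i _ => ?_
  by_cases hi : i ∈ K <;> simp [hi]

theorem pi_dirac (x : ∀ i, X i) : Measure.pi (fun i => Measure.dirac (x i)) = Measure.dirac x := by
  rw [← Measure.infinitePi_eq_pi, Measure.infinitePi_dirac]

open Classical in
theorem pi_piecewise_dirac (ν : ∀ i, Measure (X i)) [∀ i, IsProbabilityMeasure (ν i)]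
    (K : Set ι) (x : ∀ i, X i) :
    Measure.pi (K.piecewise ν fun i => Measure.dirac (x i)) =
      (Measure.pi ν).map fun y => K.piecewise y x := by
  rw [← (measurePreserving_overwrite _ ν K).map_eq, pi_dirac, Measure.dirac_prod,
    Measure.map_map (measurable_overwrite K) measurable_prodMk_left]
  rfl

theorem map_eval_pair_pi (μ : ∀ i, Measure (X i)) [∀ i, IsProbabilityMeasure (μ i)] {i j : ι}
    (hij : i ≠ j) : (Measure.pi μ).map (fun x => (x i, x j)) = (μ i).prod (μ j) := by
  have hindep : IndepFun (fun x : ∀ i, X i => x i) (fun x => x j) (Measure.pi μ) :=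
    (iIndepFun_pi (X := fun _ x => x) fun _ => aemeasurable_id).indepFun hij
  rw [(indepFun_iff_map_prod_eq_prod_map_map (measurable_pi_apply i).aemeasurable
    (measurable_pi_apply j).aemeasurable).1 hindep]
  exact congrArg₂ Measure.prod (measurePreserving_eval μ i).map_eq
    (measurePreserving_eval μ j).map_eq

end Product

theorem ae_prod_fst_ne_snd {X : Type*} [MeasurableSpace X] [MeasurableEq X] (μ ν : Measure X)
    [SFinite ν] [NullSingletonClass ν] : ∀ᵐ p ∂μ.prod ν, p.1 ≠ p.2 := by
  have hdiag : MeasurableSet {p : X × X | p.1 ≠ p.2} :=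
    (measurableSet_eq_fun measurable_fst measurable_snd).compl
  refine (Measure.ae_prod_iff_ae_ae hdiag).2 (.of_forall fun a => ?_)
  filter_upwards [measure_eq_zero_iff_ae_notMem.1 (measure_singleton (μ := ν) a)] with b hb
  exact Ne.symm hb

theorem ae_pi_injective {ι X : Type*} [Fintype ι] [MeasurableSpace X] [MeasurableEq X]
    (μ : ι → Measure X) [∀ i, IsProbabilityMeasure (μ i)] [∀ i, NullSingletonClass (μ i)] :
    ∀ᵐ x ∂Measure.pi μ, Function.Injective x := by
  have hne : ∀ i j, i ≠ j → ∀ᵐ x ∂Measure.pi μ, x i ≠ x j := fun i j hij => by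
    have hpair := ae_prod_fst_ne_snd (μ i) (μ j)
    rw [← map_eval_pair_pi μ hij] at hpair
    exact ae_of_ae_map ((measurable_pi_apply i).prodMk (measurable_pi_apply j)).aemeasurable hpair
  have hall : ∀ᵐ x ∂Measure.pi μ, ∀ i j, i ≠ j → x i ≠ x j := by
    simpa only [ae_all_iff] using hne
  filter_upwards [hall] with x hx i j
  exact not_imp_not.1 (hx i j)

/-! ### Maximal runs of relations with the diamond property -/

section DiamondProperty

/-- The diamond property of a labelled relation: two different steps from a common state can be
completed to a diamond whose opposite sides carry the same labels. -/
def HasLabelledDiamond {S W : Type*} (r : S → W → S → Prop) : Prop :=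
  ∀ s w₁ s₁ w₂ s₂, r s w₁ s₁ → r s w₂ s₂ →
    (w₁ = w₂ ∧ s₁ = s₂) ∨ ∃ s₃, r s₁ w₂ s₃ ∧ r s₂ w₁ s₃

/-- `MaximalRun r M s t`: a sequence of steps of `r` leads from `s` to the state `t`, from which
no further step is possible. The labels are collected in the multiset `M`, which forgets their
order because diamonds permute them. -/
inductive MaximalRun {S W : Type*} (r : S → W → S → Prop) : Multiset W → S → S → Prop
  | nil {s : S} : (∀ w t, ¬ r s w t) → MaximalRun r 0 s s
  | cons {w : W} {M : Multiset W} {s s' t : S} :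
      r s w s' → MaximalRun r M s' t → MaximalRun r (w ::ₘ M) s t

variable {S W : Type*} {r : S → W → S → Prop} {M M' : Multiset W} {s s' t t' : S} {w : W}

-- Completing a diamond moves the given first step past the first step of the run.
theorem MaximalRun.exists_tail (hr : HasLabelledDiamond r) (h : MaximalRun r M s t)
    (hw : r s w s') : ∃ N, M = w ::ₘ N ∧ MaximalRun r N s' t := by
  induction h generalizing w s' with
  | nil hs => exact absurd hw (hs _ _)
  | @cons w₁ M s s₁ t h₁ hrun ih =>
    obtain ⟨rfl, rfl⟩ | ⟨s₃, h₁₃, h₃⟩ := hr _ _ _ _ _ h₁ hw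
    · exact ⟨M, rfl, hrun⟩
    · obtain ⟨N, rfl, hrun'⟩ := ih h₁₃
      exact ⟨w₁ ::ₘ N, Multiset.cons_swap _ _ _, .cons h₃ hrun'⟩

theorem MaximalRun.unique (hr : HasLabelledDiamond r) (h : MaximalRun r M s t)
    (h' : MaximalRun r M' s t') : M = M' ∧ t = t' := by
  induction h generalizing M' t' with
  | nil hs =>
    cases h' with
    | nil => exact ⟨rfl, rfl⟩
    | cons hw => exact absurd hw (hs _ _)
  | cons hw _ ih =>
    obtain ⟨N, rfl, hrun⟩ := h'.exists_tail hr hw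
    obtain ⟨rfl, rfl⟩ := ih hrun
    exact ⟨rfl, rfl⟩

end DiamondProperty

namespace IOSA

variable {S A C : Type*} {I : IOSA S A C}

/-! ### Urgent transitions of closed confluent automata -/

theorem Closed.mem_output (hI : I.Closed) (a : A) : a ∈ I.output :=
  (Set.ext_iff.1 hI a).1

theorem Closed.stable_iff (hI : I.Closed) {s : S} :
    I.Stable s ↔ ∀ K s', ¬ I.UrgentTrans s K s' :=
  ⟨fun h K s' ⟨a, ha, ht⟩ => h ⟨a, ⟨ha, hI.mem_output a⟩, K, s', ht⟩,
    fun h ⟨a, ha, K, s', ht⟩ => h K s' ⟨a, ha.1, ht⟩⟩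

theorem Closed.exists_clock_of_notMem_urgent (hI : I.Closed) {s s' : S} {K K' : Set C} {a : A}
    (h : I.trans s K a K' s') (ha : a ∉ I.urgent) : ∃ x, K = {x} :=
  I.generative _ _ _ _ _ h ⟨hI.mem_output a, ha⟩

theorem Closed.exists_clock_of_stable (hI : I.Closed) {s s' : S} {K K' : Set C} {a : A}
    (h : I.trans s K a K' s') (hs : I.Stable s) : ∃ x, K = {x} := by
  refine hI.exists_clock_of_notMem_urgent h fun ha => ?_
  obtain rfl := I.reactive _ _ _ _ _ h (.inr ha)
  exact hI.stable_iff.1 hs _ _ ⟨a, ha, h⟩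

theorem Confluent.hasLabelledDiamond (hc : I.Confluent) : HasLabelledDiamond I.UrgentTrans := by
  rintro s K₁ s₁ K₂ s₂ ⟨a, ha, h₁⟩ ⟨b, hb, h₂⟩
  obtain ⟨-, hK, hs⟩ | ⟨s₃, h₁₃, h₂₃⟩ := hc a ha b hb _ _ _ _ _ h₁ h₂
  · exact .inl ⟨hK, hs⟩
  · exact .inr ⟨s₃, ⟨b, hb, h₁₃⟩, a, ha, h₂₃⟩

variable (I) in
/-- `I.UrgentRun n K s t`: a maximal sequence of urgent transitions leads from `s` to `t`, has
length `n ≥ 1`, and resets exactly the clocks in `K`. These runs are the discrete skeleton of the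
weak transitions. -/
def UrgentRun (n : ℕ) (K : Set C) (s t : S) : Prop :=
  ∃ M : Multiset (Set C), M ≠ 0 ∧ MaximalRun I.UrgentTrans M s t ∧ M.card = n ∧ M.sup = K

theorem not_urgentRun_zero {K : Set C} {s t : S} : ¬ I.UrgentRun 0 K s t :=
  fun ⟨_, hM, _, hcard, _⟩ => hM (Multiset.card_eq_zero.1 hcard)

theorem Closed.urgentRun_succ_iff (hI : I.Closed) {n : ℕ} {K : Set C} {s t : S} :
    I.UrgentRun (n + 1) K s t ↔ (n = 0 ∧ I.UrgentTrans s K t ∧ I.Stable t) ∨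
      ∃ K' s' K'', I.UrgentTrans s K' s' ∧ I.UrgentRun n K'' s' t ∧ K = K' ∪ K'' := by
  constructor
  · rintro ⟨M, hM, hrun, hcard, rfl⟩
    obtain _ | @⟨K', M, _, s', _, htrans, hrun⟩ := hrun
    · exact absurd rfl hM
    obtain rfl : M.card = n := by simpa using hcard
    obtain hterm | ⟨htrans', hrun'⟩ := hrun
    · exact .inl ⟨rfl, by simpa using htrans, hI.stable_iff.2 hterm⟩
    · exact .inr ⟨K', s', _, htrans, ⟨_, Multiset.cons_ne_zero, .cons htrans' hrun', rfl, rfl⟩,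
        Multiset.sup_cons _ _⟩
  · rintro (⟨rfl, htrans, ht⟩ | ⟨K', s', K'', htrans, ⟨M, -, hrun, rfl, rfl⟩, rfl⟩)
    · exact ⟨{K}, Multiset.singleton_ne_zero K, .cons htrans (.nil (hI.stable_iff.1 ht)), rfl,
        Multiset.sup_singleton⟩
    · exact ⟨K' ::ₘ M, Multiset.cons_ne_zero, .cons htrans hrun, Multiset.card_cons _ _,
        Multiset.sup_cons _ _⟩

theorem UrgentRun.unique (hc : I.Confluent) {n n' : ℕ} {K K' : Set C} {s t t' : S}
    (h : I.UrgentRun n K s t) (h' : I.UrgentRun n' K' s t') : K = K' ∧ t = t' := by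
  obtain ⟨M, -, hrun, -, rfl⟩ := h
  obtain ⟨M', -, hrun', -, rfl⟩ := h'
  obtain ⟨rfl, rfl⟩ := hrun.unique hc.hasLabelledDiamond hrun'
  exact ⟨rfl, rfl⟩

/-! ### Resampling clocks -/

section Resampling

variable [Fintype C]

variable (I) in
/-- The joint distribution of independent samples of all the clocks. -/
noncomputable def clockLaw : Measure (C → ℝ) := Measure.pi fun x => (I.clock x : Measure ℝ)

instance : IsProbabilityMeasure I.clockLaw := by
  unfold clockLaw
  infer_instance

theorem coe_locProd (q : Loc S) (m : C → ProbabilityMeasure ℝ) :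
    (locProd q m : Measure (SemState S C)) =
      (Measure.pi fun x => (m x : Measure ℝ)).map (Prod.mk q) :=
  Measure.dirac_prod q

theorem coe_locProd_diracProba (q : Loc S) (v : C → ℝ) :
    (locProd q (fun x => diracProba (v x)) : Measure (SemState S C)) = Measure.dirac (q, v) := by
  rw [coe_locProd]
  exact (congrArg _ (pi_dirac v)).trans (Measure.map_dirac' measurable_prodMk_left _)

open Classical in
theorem coe_resample (v : C → ℝ) (K : Set C) (s : S) :
    (I.resample v K s : Measure (SemState S C)) =
      I.clockLaw.map fun w => (Loc.at s, K.piecewise w v) := by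
  have hpi : (Measure.pi fun x =>
      ((if x ∈ K then I.clock x else diracProba (v x) : ProbabilityMeasure ℝ) : Measure ℝ)) =
        I.clockLaw.map fun w => K.piecewise w v := by
    rw [clockLaw, ← pi_piecewise_dirac]
    congr 1
    ext1 x
    by_cases hx : x ∈ K <;> simp [hx, diracProba]
  rw [resample, coe_locProd, hpi]
  exact Measure.map_map measurable_prodMk_left
    ((measurable_overwrite K).comp measurable_prodMk_left)

theorem measurable_resample (K : Set C) (f : Loc S → S) :
    Measurable fun p : SemState S C => (I.resample p.2 K (f p.1) : Measure (SemState S C)) := by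
  classical
  have hf : Measurable fun p : SemState S C × (C → ℝ) =>
      ((Loc.at (f p.1.1), K.piecewise p.2 p.1.2) : SemState S C) :=
    ((Measurable.of_discrete (f := fun q => Loc.at (f q))).comp
      (measurable_fst.comp measurable_fst)).prodMk
        ((measurable_overwrite K).comp ((measurable_snd.comp measurable_fst).prodMk measurable_snd))
  have hmap : ∀ p : SemState S C, (I.resample p.2 K (f p.1) : Measure (SemState S C)) =
      (I.clockLaw.map (Prod.mk p)).map fun p => (Loc.at (f p.1.1), K.piecewise p.2 p.1.2) :=
    fun p => (coe_resample _ _ _).trans (Measure.map_map hf measurable_prodMk_left).symm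
  simp only [hmap]
  exact (Measure.measurable_map _ hf).comp Measurable.map_prodMk_left

theorem resample_bind {v : C → ℝ} {K K' : Set C} {s t : S}
    {f : SemState S C → Measure (SemState S C)} (hf : Measurable f)
    (hft : ∀ u, f (.at s, u) = I.resample u K' t) :
    (I.resample v K s : Measure (SemState S C)).bind f = I.resample v (K ∪ K') t := by
  classical
  have hov : MeasurePreserving (fun p : (C → ℝ) × (C → ℝ) => K'.piecewise p.2 p.1)
      (I.clockLaw.prod I.clockLaw) I.clockLaw := by
    simpa only [clockLaw, Set.piecewise_same] using measurePreserving_overwrite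
      (fun x => (I.clock x : Measure ℝ)) (fun x => (I.clock x : Measure ℝ)) K'
  let reset (K : Set C) (s : S) (w : C → ℝ) : SemState S C := (.at s, K.piecewise w v)
  have hreset : ∀ K s, Measurable (reset K s) := fun K s =>
    measurable_const.prodMk ((measurable_overwrite K).comp measurable_prodMk_left)
  have hcomp : ∀ w, (I.resample (K.piecewise w v) K' t : Measure (SemState S C)) =
      I.clockLaw.map fun w' => reset (K ∪ K') t (K'.piecewise w' w) := fun w => by
    rw [coe_resample]
    congr 1 with w' : 1
    exact congrArg (Prod.mk _) (piecewise_piecewise_eq_union_piecewise ..)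
  calc (I.resample v K s : Measure (SemState S C)).bind f
      = I.clockLaw.bind fun w => f (reset K s w) := by
        rw [coe_resample, Measure.bind, Measure.map_map hf (hreset K s)]
        rfl
    _ = I.clockLaw.bind fun w => I.clockLaw.map fun w' =>
          reset (K ∪ K') t (K'.piecewise w' w) := by
        simp only [reset, hft, hcomp]
    _ = (I.clockLaw.prod I.clockLaw).map fun p => reset (K ∪ K') t (K'.piecewise p.2 p.1) :=
        bind_map_prodMk _ _ (f := reset (K ∪ K') t ∘ fun p => K'.piecewise p.2 p.1)
          ((hreset _ _).comp hov.measurable)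
    _ = I.clockLaw.map (reset (K ∪ K') t) := by
        rw [← Function.comp_def, ← Measure.map_map (hreset _ _) hov.measurable, hov.map_eq]
    _ = I.resample v (K ∪ K') t := (coe_resample _ _ _).symm

theorem ae_clockLaw_injective : ∀ᵐ w ∂I.clockLaw, Function.Injective w :=
  have (x : C) : NullSingletonClass (I.clock x : Measure ℝ) := ⟨I.clock_continuous x⟩
  ae_pi_injective _

theorem ae_clockLaw_ne (x : C) (r : ℝ) : ∀ᵐ w ∂I.clockLaw, w x ≠ r :=
  have : NullSingletonClass (I.clock x : Measure ℝ) := ⟨I.clock_continuous x⟩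
  Measure.ae_eval_ne (μ := fun x => (I.clock x : Measure ℝ)) x r

theorem ae_clockLaw_pos (x : C) : ∀ᵐ w ∂I.clockLaw, 0 < w x :=
  Measure.tendsto_eval_ae_ae.eventually
    ((prob_compl_eq_zero_iff measurableSet_Ioi).2 (I.clock_pos x))

end Resampling

/-! ### Weak transitions -/

theorem measureOf_eq {R : SemState S C → Measure (SemState S C) → Prop} {p : SemState S C}
    {μ : Measure (SemState S C)} (h : R p μ) (huniq : ∀ ν, R p ν → ν = μ) :
    measureOf R p = μ := by
  have hex : ∃ ν, R p ν := ⟨μ, h⟩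
  rw [measureOf, dif_pos hex]
  exact huniq _ hex.choose_spec

theorem measureOf_eq_zero {R : SemState S C → Measure (SemState S C) → Prop} {p : SemState S C}
    (h : ∀ ν, ¬ R p ν) : measureOf R p = 0 := by
  rw [measureOf, dif_neg (not_exists.2 h)]

section WeakTransitions

variable [Fintype C]

variable (I) in
/-- The relation on the semantics induced by the urgent runs of length `n` that reset `K`. For
closed confluent automata it describes the weak transitions without any integration. -/
def RunStep (n : ℕ) (K : Set C) (p : SemState S C) (μ : Measure (SemState S C)) : Prop :=
  ∃ s t, p.1 = .at s ∧ I.UrgentRun n K s t ∧ μ = I.resample p.2 K t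

variable {n n' : ℕ} {K K' : Set C}

theorem RunStep.unique (hc : I.Confluent) {p : SemState S C} {μ μ' : Measure (SemState S C)}
    (h : I.RunStep n K p μ) (h' : I.RunStep n' K' p μ') : μ = μ' := by
  obtain ⟨s, t, hs, hrun, rfl⟩ := h
  obtain ⟨s', t', hs', hrun', rfl⟩ := h'
  obtain rfl : s = s' := Loc.at.inj (hs.symm.trans hs')
  obtain ⟨rfl, rfl⟩ := hrun.unique hc hrun'
  rfl

theorem measureOf_runStep (hc : I.Confluent) {s t : S} (h : I.UrgentRun n K s t) (v : C → ℝ) :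
    measureOf (I.RunStep n K) (.at s, v) = I.resample v K t :=
  have hR : I.RunStep n K (.at s, v) (I.resample v K t) := ⟨s, t, rfl, h, rfl⟩
  measureOf_eq hR fun _ hν => hν.unique hc hR

theorem measurable_measureOf_runStep (hc : I.Confluent) (n : ℕ) (K : Set C) :
    Measurable (measureOf (I.RunStep n K)) := by
  classical
  let HasRun (q : Loc S) (t : S) : Prop := ∃ s, q = .at s ∧ I.UrgentRun n K s t
  have hend : ∀ q, ∃ t, (∃ t', HasRun q t') → HasRun q t := fun q => by
    by_cases h : ∃ t', HasRun q t'
    · exact ⟨h.choose, fun _ => h.choose_spec⟩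
    · exact ⟨I.s₀, fun h' => absurd h' h⟩
  choose target htarget using hend
  have heq : measureOf (I.RunStep n K) = fun p =>
      if ∃ t, HasRun p.1 t then (I.resample p.2 K (target p.1) : Measure (SemState S C))
      else 0 := by
    ext1 ⟨q, v⟩
    split_ifs with h
    · obtain ⟨s, rfl, hrun⟩ := htarget q h
      exact measureOf_runStep hc hrun v
    · exact measureOf_eq_zero fun ν ⟨s, t, hs, hrun, _⟩ => h ⟨t, s, hs, hrun⟩
  rw [heq]
  exact Measurable.ite (measurable_fst (.of_discrete (s := {q | ∃ t, HasRun q t})))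
    (measurable_resample K target) measurable_const

theorem resample_bind_measureOf_runStep (hc : I.Confluent) {s t : S} (h : I.UrgentRun n K' s t)
    (v : C → ℝ) :
    (I.resample v K s : Measure (SemState S C)).bind (measureOf (I.RunStep n K')) =
      I.resample v (K ∪ K') t :=
  resample_bind (measurable_measureOf_runStep hc n K') (measureOf_runStep hc h)

theorem weakStep_eq_runStep (hI : I.Closed) (hc : I.Confluent) (n : ℕ) :
    I.WeakStep n = I.RunStep n := by
  induction n with
  | zero =>
    ext K p μ
    simp only [WeakStep, RunStep, not_urgentRun_zero, false_and, and_false, exists_false]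
  | succ n ih =>
    ext K p μ
    rw [WeakStep, ih]
    simp only [RunStep, hI.urgentRun_succ_iff]
    constructor
    · rintro (⟨hn, s, t, hp, htrans, ht, hμ⟩ | ⟨s, K', s', K'', hp, htrans, hrun, rfl, rfl⟩)
      · exact ⟨s, t, hp, .inl ⟨hn, htrans, ht⟩, hμ⟩
      · obtain ⟨_, _, t, hs, hrun, -⟩ := hrun 0
        obtain rfl := Loc.at.inj hs
        exact ⟨s, t, hp, .inr ⟨K', s', K'', htrans, hrun, rfl⟩,
          resample_bind_measureOf_runStep hc hrun _⟩
    · rintro ⟨s, t, hp, ⟨hn, htrans, ht⟩ | ⟨K', s', K'', htrans, hrun, rfl⟩, rfl⟩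
      · exact .inl ⟨hn, s, t, hp, htrans, ht, rfl⟩
      · exact .inr ⟨s, K', s', K'', hp, htrans, fun v' => ⟨_, s', t, rfl, hrun, rfl⟩, rfl,
          (resample_bind_measureOf_runStep hc hrun _).symm⟩

theorem weakTransWellDefined (hI : I.Closed) (hc : I.Confluent) : I.WeakTransWellDefined := by
  intro n _ K
  rw [weakStep_eq_runStep hI hc]
  exact ⟨fun p μ μ' h h' => h.unique hc h', measurable_measureOf_runStep hc n K⟩

theorem not_twoWeak (hI : I.Closed) (hc : I.Confluent) (p : SemState S C) : ¬ I.TwoWeak p := by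
  rintro ⟨-, μ, μ', ⟨n, -, K, h⟩, ⟨n', -, K', h'⟩, hne⟩
  rw [weakStep_eq_runStep hI hc] at h h'
  exact hne (h.unique hc h')

end WeakTransitions

/-! ### Regular states -/

variable (I) in
/-- The conditions that an IOSA imposes on the active clocks of its states, except for the one on
the initial state. -/
structure IsActive (active : S → Set C) : Prop where
  enabling_subset : ∀ s, enablingClocks I.trans s ⊆ active s
  eq_enabling : ∀ s, I.Stable s → active s = enablingClocks I.trans s
  trans_subset : ∀ t K a K' s, I.trans t K a K' s → active s ⊆ (active t \ K) ∪ K'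

/-- The active clocks of a location. No clock is active in `init`, where the clock values are
arbitrary. -/
def activeAt (active : S → Set C) : Loc S → Set C
  | .init => ∅
  | .at s => active s

variable (I) in
/-- The states in which the active clocks have pairwise different values, all of them nonnegative
and, if the location is unstable, positive. -/
def regularStates (active : S → Set C) : Set (SemState S C) :=
  {p | (activeAt active p.1).InjOn p.2 ∧ (∀ x ∈ activeAt active p.1, 0 ≤ p.2 x) ∧
    (¬ I.StableLoc p.1 → ∀ x ∈ activeAt active p.1, 0 < p.2 x)}

theorem init_mem_regularStates (active : S → Set C) (v : C → ℝ) :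
    (.init, v) ∈ I.regularStates active :=
  ⟨Set.injOn_empty v, fun _ => False.elim, fun h => absurd trivial h⟩

theorem measurableSet_regularStates [Countable C] (active : S → Set C) :
    MeasurableSet (I.regularStates active) := by
  have hloc (P : Loc S → Prop) : Measurable fun p : SemState S C => P p.1 :=
    (Measurable.of_discrete (f := P)).comp measurable_fst
  have hval (x : C) : Measurable fun p : SemState S C => p.2 x :=
    (measurable_pi_apply x).comp measurable_snd
  have hactive (x : C) := hloc fun q => x ∈ activeAt active q
  refine measurableSet_setOfPred.2 (.and ?_ (.and ?_ ?_))
  · exact .forall fun x => (hactive x).imp <| .forall fun y => (hactive y).imp <|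
      (measurableSet_setOfPred.1 (measurableSet_eq_fun (hval x) (hval y))).imp measurable_const
  · exact .forall fun x => (hactive x).imp <|
      measurableSet_setOfPred.1 (measurableSet_le measurable_const (hval x))
  · exact (hloc fun q => ¬ I.StableLoc q).imp <| .forall fun x => (hactive x).imp <|
      measurableSet_setOfPred.1 (measurableSet_lt measurable_const (hval x))

section Active

variable {active : S → Set C}

theorem IsActive.eq_zero_of_trans (hact : I.IsActive active) {s s' : S} {v : C → ℝ} {x : C}
    {a : A} {K' : Set C} (hp : (.at s, v) ∈ I.regularStates active)
    (h : I.trans s {x} a K' s') (hx : v x ≤ 0) : v x = 0 :=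
  hx.antisymm (hp.2.1 x (hact.enabling_subset s ⟨a, K', s', h⟩))

theorem IsActive.pos_of_trans (hact : I.IsActive active) (hI : I.Closed) {s s' : S} {v : C → ℝ}
    {K K' : Set C} {a : A} (hp : (.at s, v) ∈ I.regularStates active) (h : I.trans s K a K' s')
    (hK : ∀ x ∈ K, v x ≤ 0) : ∀ x ∈ active s \ K, 0 < v x := by
  rintro x ⟨hx, hxK⟩
  by_cases hs : I.Stable s
  · obtain ⟨y, rfl⟩ := hI.exists_clock_of_stable h hs
    have hy : v y = 0 := hact.eq_zero_of_trans hp h (hK y rfl)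
    have hxy : v x ≠ v y := fun hv =>
      hxK (hp.1 hx (hact.enabling_subset s ⟨a, K', s', h⟩) hv)
    exact (hp.2.1 x hx).lt_of_ne (hy ▸ hxy.symm)
  · exact hp.2.2 hs x hx

theorem IsActive.mem_regularStates_of_canDelay (hact : I.IsActive active) (hI : I.Closed)
    {q : Loc S} {v : C → ℝ} (hp : (q, v) ∈ I.regularStates active) {d : ℝ}
    (hd : I.CanDelay d (q, v)) : (q, fun x => v x - d) ∈ I.regularStates active := by
  obtain _ | s := q
  · exact init_mem_regularStates active _
  have hs : I.Stable s := hI.stable_iff.2 fun K s' ⟨a, ha, h⟩ =>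
    hd.1 ⟨a, ⟨hI.mem_output a, ha⟩, ∅, K, s', h⟩
  refine ⟨fun x hx y hy hxy => hp.1 hx hy (sub_left_injective hxy), fun x hx => ?_, absurd hs⟩
  obtain ⟨a, K', s', h⟩ := (hact.eq_enabling s hs).subset hx
  exact sub_nonneg.2 (hd.2 x ⟨a, hI.mem_output a, K', s', h⟩)

theorem IsActive.not_nonUrgentUnstable [Fintype C] (hact : I.IsActive active) (hI : I.Closed)
    {p : SemState S C} (hp : p ∈ I.regularStates active) : ¬ I.NonUrgentUnstable p := by
  rintro ⟨hs, a, ha, μ, hμ⟩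
  obtain ⟨_ | s, v⟩ := p
  · exact hμ
  obtain ⟨K, K', s', h, hK, rfl⟩ := hμ
  obtain ⟨x, rfl⟩ := hI.exists_clock_of_notMem_urgent h ha.2
  exact (hK x rfl).not_gt (hp.2.2 hs x (hact.enabling_subset s ⟨a, K', s', h⟩))

theorem IsActive.not_twoDiscrete [Fintype C] (hact : I.IsActive active) (hI : I.Closed)
    {p : SemState S C} (hp : p ∈ I.regularStates active) : ¬ I.TwoDiscrete p := by
  rintro ⟨hs, a, b, μ, hμ, μ', hμ', hne⟩
  obtain ⟨_ | s, v⟩ := p <;> obtain _ | a := a <;> obtain _ | b := b <;>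
    first | exact hμ.elim | exact hμ'.elim | skip
  · exact hne (Eq.trans (b := locProd (.at I.s₀) I.clock) hμ (Eq.symm hμ'))
  · obtain ⟨K₁, K₁', s₁, h₁, hK₁, rfl⟩ := hμ
    obtain ⟨K₂, K₂', s₂, h₂, hK₂, rfl⟩ := hμ'
    obtain ⟨x, rfl⟩ := hI.exists_clock_of_stable h₁ hs
    obtain ⟨y, rfl⟩ := hI.exists_clock_of_stable h₂ hs
    obtain rfl : x = y := hp.1 (hact.enabling_subset s ⟨a, K₁', s₁, h₁⟩)
      (hact.enabling_subset s ⟨b, K₂', s₂, h₂⟩)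
      ((hact.eq_zero_of_trans hp h₁ (hK₁ x rfl)).trans
        (hact.eq_zero_of_trans hp h₂ (hK₂ y rfl)).symm)
    obtain ⟨-, rfl, rfl⟩ := I.clock_controls_one _ _ _ _ _ _ _ _ h₁ h₂
    exact hne rfl

variable [Fintype C]

theorem ae_resample_mem_regularStates {D K : Set C} {v : C → ℝ} {s : S} (hinj : D.InjOn v)
    (hpos : ∀ x ∈ D, 0 < v x) (hs : active s ⊆ D ∪ K) :
    ∀ᵐ p ∂(I.resample v K s : Measure (SemState S C)), p ∈ I.regularStates active := by
  classical
  have hmeas : Measurable fun w : C → ℝ => (Loc.at s, K.piecewise w v) :=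
    measurable_const.prodMk ((measurable_overwrite K).comp measurable_prodMk_left)
  rw [coe_resample]
  refine (ae_map_iff hmeas.aemeasurable (measurableSet_regularStates active)).2 ?_
  have hne : ∀ᵐ w ∂I.clockLaw, ∀ x y, w x ≠ v y :=
    ae_all_iff.2 fun x => ae_all_iff.2 fun y => ae_clockLaw_ne x (v y)
  filter_upwards [ae_clockLaw_injective, hne, ae_all_iff.2 ae_clockLaw_pos] with w hw hne hwpos
  have hall : ∀ x ∈ active s, 0 < K.piecewise w v x := fun x hx => by
    by_cases hxK : x ∈ K
    · simpa [hxK] using hwpos x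
    · simpa [hxK] using hpos x ((hs hx).resolve_right hxK)
  exact ⟨(injOn_union_piecewise hinj hw.injOn hne).mono hs, fun x hx => (hall x hx).le,
    fun _ => hall⟩

theorem IsActive.ae_mem_regularStates_of_discreteT (hact : I.IsActive active) (hI : I.Closed)
    {p : SemState S C} (hp : p ∈ I.regularStates active) {ℓ : DiscreteLabel A}
    {μ : ProbabilityMeasure (SemState S C)} (hμ : μ ∈ I.discreteT ℓ p) :
    ∀ᵐ q ∂(μ : Measure (SemState S C)), q ∈ I.regularStates active := by
  obtain ⟨_ | s, v⟩ := p <;> obtain _ | a := ℓ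
  · have hinit : I.resample v Set.univ I.s₀ = locProd (.at I.s₀) I.clock := by
      simp only [resample, Set.mem_univ, if_true]
    obtain rfl : μ = I.resample v Set.univ I.s₀ := Eq.trans hμ hinit.symm
    exact ae_resample_mem_regularStates (Set.injOn_empty v) (by simp)
      (Set.subset_union_of_subset_right (Set.subset_univ _) ∅)
  · exact hμ.elim
  · exact hμ.elim
  · obtain ⟨K, K', s', h, hK, rfl⟩ := hμ
    exact ae_resample_mem_regularStates (hp.1.mono Set.sdiff_subset)
      (hact.pos_of_trans hI hp h hK) (hact.trans_subset _ _ _ _ _ h)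

theorem IsActive.almostSurelyInvariant_regularStates (hact : I.IsActive active) (hI : I.Closed) :
    AlmostSurelyInvariant I.semT (I.regularStates active) := by
  rintro p hp (ℓ | d) μ hμ
  · exact hact.ae_mem_regularStates_of_discreteT hI hp hμ
  · obtain ⟨hd, rfl⟩ := hμ
    rw [coe_locProd_diracProba]
    exact (ae_dirac_iff (measurableSet_regularStates active)).2 <|
      hact.mem_regularStates_of_canDelay hI hp hd

end Active

end IOSA

theorem mainTheorem1_general {S A C : Type*} [Fintype C] (I : IOSA S A C) (hclosed : I.Closed)
    (hconfluent : I.Confluent) : I.WeaklyDeterministic := by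
  refine ⟨IOSA.weakTransWellDefined hclosed hconfluent, fun v₀ B _ hB => ?_⟩
  obtain ⟨active, -, henabling, hstable, htrans⟩ := I.exists_active
  have hact : I.IsActive active := ⟨henabling, hstable, htrans⟩
  have hdisj : Disjoint B (I.regularStates active) := Set.disjoint_left.2 fun p hpB hp => by
    obtain h | h | h := hB p hpB
    · exact hact.not_twoDiscrete hclosed hp h
    · exact IOSA.not_twoWeak hclosed hconfluent p h
    · exact hact.not_nonUrgentUnstable hclosed hp h
  exact (hact.almostSurelyInvariant_regularStates hclosed).almostNeverReached
    (IOSA.measurableSet_regularStates active) (IOSA.init_mem_regularStates active v₀) hdisj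

theorem mainTheorem1 {S A C : Type*} [Countable S] [Countable A] [Fintype C]
    (I : IOSA S A C) (hclosed : I.Closed) (hconfluent : I.Confluent) :
    I.WeaklyDeterministic :=
  mainTheorem1_general I hclosed hconfluent
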